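/- For an integer $d\ge 1$, let $\tau_{\pm1}(d)$ denote the largest integer $t$ for which there is a sequence $v_1,\ldots,v_t$ of vectors in $\{-1,+1\}^d$ such that (i) the sum $v_1+\cdots+v_t$ lies in the box $[-1,1]^d$, and (ii) for every set of indices $S\subset\{1,\ldots,t\}$ with $2\le |S|<t$, the sum $\sum_{i\in S}v_i$ lies outside $[-1,1]^d$. (This maximum is finite.) Then there is a constant $c>0$ such that $$\tau_{\pm 1}(d)\ \ge\ (cd)^{d/4}$$ for all $d$ that are powers of $2$. -/

import Mathlib

/-- The box `[-1,1]^d`. -/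
def unitBox (d : ℕ) : Set (Fin d → ℝ) :=
  {x | ∀ j, -1 ≤ x j ∧ x j ≤ 1}

/-- A sequence `v_1, …, v_t` of vectors in the box is a *minimal sequence with sum in the box* if
(i) its sum lies in the box and (ii) the sum over every proper subset `S` of the indices with
`2 ≤ |S| < t` lies outside the box. -/
structure IsMinimalBoxSequence {d t : ℕ} (v : Fin t → Fin d → ℝ) : Prop where
  mem_box : ∀ i, v i ∈ unitBox d
  sum_mem_box : ∑ i, v i ∈ unitBox d
  minimal : ∀ S : Finset (Fin t), 2 ≤ S.card → S.card < t → ∑ i ∈ S, v i ∉ unitBox d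

/-- The lengths of the minimal sequences in dimension `d` that consist of `±1` vectors only. -/
def pmLengths (d : ℕ) : Set ℕ :=
  {t | ∃ v : Fin t → Fin d → ℝ, (∀ i j, v i j = 1 ∨ v i j = -1) ∧ IsMinimalBoxSequence v}

/-- `τ_{±1}(d)`: the largest length of a minimal sequence of `±1` vectors in dimension `d`.
The maximum exists, see `tauPM_isGreatest`. -/
noncomputable def tauPM (d : ℕ) : ℕ := sSup (pmLengths d)

/-- The lengths are bounded, by Dickson's lemma. -/
theorem pmLengths_bddAbove (d : ℕ) : BddAbove (pmLengths d) := by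
  classical
  by_contra hb
  rw [not_bddAbove_iff] at hb
  have step : ∀ N : ℕ, ∃ t, t ∈ pmLengths d ∧ N < t := by
    intro N
    obtain ⟨t, ht, hN⟩ := hb N
    exact ⟨t, ht, hN⟩
  choose T hT hTlt using step
  let a : ℕ → ℕ := fun n => T^[n] (T 2)
  have ha_succ : ∀ n, a (n + 1) = T (a n) := fun n => Function.iterate_succ_apply' T n (T 2)
  have ha_mono : StrictMono a :=
    strictMono_nat_of_lt_succ (fun n => by rw [ha_succ]; exact hTlt (a n))
  have ha_mem : ∀ n, a n ∈ pmLengths d := by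
    intro n
    cases n with
    | zero => exact hT 2
    | succ k => rw [ha_succ]; exact hT (a k)
  have ha_two : ∀ n, 2 ≤ a n := fun n =>
    (le_of_lt (hTlt 2)).trans (ha_mono.monotone (Nat.zero_le n))
  choose v hv hmin using ha_mem
  let s : ∀ n, Fin (a n) → (Fin d → Bool) := fun n i j => decide (v n i j = 1)
  let u : (Fin d → Bool) → (Fin d → ℝ) := fun b j => if b j then 1 else -1
  have hu : ∀ n i, v n i = u (s n i) := by
    intro n i
    funext j
    rcases hv n i j with h | h
    · simp [u, s, h]
    · have : ¬ ((-1 : ℝ) = 1) := by norm_num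
      simp [u, s, h, this]
  clear_value a
  let cnt : ℕ → ((Fin d → Bool) → ℕ) := fun n b =>
    ((Finset.univ : Finset (Fin (a n))).filter (fun i => s n i = b)).card
  obtain ⟨m, n, hmn, hle⟩ := (wellQuasiOrdered_le (α := (Fin d → Bool) → ℕ)) cnt
  have hsub : ∀ b, ∃ F : Finset (Fin (a n)),
      F ⊆ Finset.univ.filter (fun i => s n i = b) ∧ F.card = cnt m b :=
    fun b => Finset.exists_subset_card_eq (hle b)
  choose F hF hFc using hsub
  have hFs : ∀ b, ∀ i ∈ F b, s n i = b := fun b i hi => (Finset.mem_filter.1 (hF b hi)).2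
  have hdisj : ((Finset.univ : Finset (Fin d → Bool)) : Set (Fin d → Bool)).PairwiseDisjoint F := by
    intro b _ b' _ hbb
    refine Finset.disjoint_left.2 (fun i hi hi' => hbb ?_)
    rw [← hFs b i hi, ← hFs b' i hi']
  have hcard : (Finset.univ.biUnion F).card = a m := by
    rw [Finset.card_biUnion (fun b hb b' hb' h => hdisj hb hb' h)]
    simp only [hFc, cnt]
    have h := Finset.card_eq_sum_card_fiberwise (s := (Finset.univ : Finset (Fin (a m))))
      (t := Finset.univ) (f := s m) (fun i _ => Finset.mem_coe.2 (Finset.mem_univ (s m i)))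
    rw [← h, Finset.card_univ, Fintype.card_fin]
  have hsum : ∑ i ∈ Finset.univ.biUnion F, v n i = ∑ i, v m i := by
    rw [Finset.sum_biUnion hdisj, ← Finset.sum_fiberwise Finset.univ (s m) (v m)]
    refine Finset.sum_congr rfl (fun b _ => ?_)
    rw [Finset.sum_congr rfl (fun i hi => by rw [hu n i, hFs b i hi] : ∀ i ∈ F b, v n i = u b),
      Finset.sum_congr rfl (fun i hi => by rw [hu m i, (Finset.mem_filter.1 hi).2] :
        ∀ i ∈ Finset.univ.filter (fun i => s m i = b), v m i = u b),
      Finset.sum_const, Finset.sum_const, hFc]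
  refine (hmin n).minimal (Finset.univ.biUnion F) ?_ ?_ ?_
  · rw [hcard]; exact ha_two m
  · rw [hcard]; exact ha_mono hmn
  · rw [hsum]; exact (hmin m).sum_mem_box

/-- `τ_{±1}(d)` is indeed a maximum. -/
theorem tauPM_isGreatest (d : ℕ) : IsGreatest (pmLengths d) (tauPM d) := by
  have hne : (pmLengths d).Nonempty :=
    ⟨0, fun i => i.elim0, fun i => i.elim0,
      ⟨fun i => i.elim0, by simp [unitBox], fun S _ h => absurd h (Nat.not_lt_zero _)⟩⟩
  exact ⟨Nat.sSup_mem hne (pmLengths_bddAbove d), fun t ht => le_csSup (pmLengths_bddAbove d) ht⟩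

/-- A finite sequence with prescribed multiplicities. -/
theorem exists_fin_fiber_card {P : Type*} [Fintype P] [DecidableEq P] (μ : P → ℕ) {t : ℕ}
    (ht : ∑ p, μ p = t) :
    ∃ φ : Fin t → P, ∀ p, (Finset.univ.filter (fun k => φ k = p)).card = μ p := by
  have hc : Fintype.card (Σ p, Fin (μ p)) = t := by simp [ht]
  let e := Fintype.equivFinOfCardEq hc
  refine ⟨fun k => (e.symm k).1, fun p => ?_⟩
  rw [← Fintype.card_fin (μ p), ← Finset.card_univ]
  symm
  refine Finset.card_bij (fun a _ => e ⟨p, a⟩) ?_ ?_ ?_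
  · intro a _; simp
  · intro a _ b _ h
    simpa using h
  · intro k hk
    obtain ⟨x, rfl⟩ := e.surjective k
    obtain ⟨q, a⟩ := x
    simp at hk
    subst hk
    exact ⟨a, Finset.mem_univ _, rfl⟩

/-- An integer vector of squared norm one is a signed unit vector. -/
theorem exists_eq_single_of_sum_sq_eq_one {ι : Type*} [Fintype ι] [DecidableEq ι] (x : ι → ℤ)
    (h : ∑ i, x i ^ 2 = 1) : ∃ i δ, (δ = 1 ∨ δ = -1) ∧ x = Pi.single i δ := by
  obtain ⟨i, hi⟩ : ∃ i, x i ≠ 0 := by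
    by_contra! hx
    simp [hx] at h
  have h1 : 1 ≤ x i ^ 2 := by
    have := sq_nonneg (x i)
    have : x i ^ 2 ≠ 0 := pow_ne_zero 2 hi
    omega
  rw [← Finset.add_sum_erase _ _ (Finset.mem_univ i)] at h
  have hnn : 0 ≤ ∑ j ∈ Finset.univ.erase i, x j ^ 2 := Finset.sum_nonneg fun j _ => sq_nonneg _
  have h0 : ∑ j ∈ Finset.univ.erase i, x j ^ 2 = 0 := by omega
  have hi1 : x i ^ 2 = 1 := by omega
  refine ⟨i, x i, by simpa using hi1, ?_⟩
  funext j
  by_cases hj : j = i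
  · subst hj; simp
  · rw [Pi.single_eq_of_ne hj]
    have := (Finset.sum_eq_zero_iff_of_nonneg (fun j _ => sq_nonneg (x j))).1 h0 j (by simp [hj])
    exact pow_eq_zero_iff two_ne_zero |>.1 this

/-- A matrix–vector product with a `±1` matrix has the parity of the sum of the entries. -/
theorem two_dvd_mulVec_sub_sum {R ι : Type*} [Fintype ι] (A : Matrix R ι ℤ)
    (hA : ∀ r i, A r i = 1 ∨ A r i = -1) (x : ι → ℤ) (r : R) :
    2 ∣ (A.mulVec x) r - ∑ i, x i := by
  rw [Matrix.mulVec, dotProduct, ← Finset.sum_sub_distrib]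
  refine Finset.dvd_sum fun i _ => ?_
  rcases hA r i with h | h <;> rw [h]
  · simp
  · exact ⟨-x i, by ring⟩

theorem two_dvd_sum_abs_sub_sum {ι : Type*} [Fintype ι] (x : ι → ℤ) :
    2 ∣ ∑ i, |x i| - ∑ i, x i := by
  rw [← Finset.sum_sub_distrib]
  refine Finset.dvd_sum fun i _ => ?_
  rcases abs_choice (x i) with h | h <;> rw [h]
  · simp
  · exact ⟨-x i, by ring⟩

/-- A vector that is dominated by a shortest kernel vector is zero or equally long. -/
theorem eq_zero_or_abs_eq_of_mulVec_eq_zero {R ι : Type*} [Fintype ι] {A : Matrix R ι ℤ} {g : ι → ℤ}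
    (hmin : ∀ x, A.mulVec x = 0 → x ≠ 0 → ∑ i, |g i| ≤ ∑ i, |x i|)
    {x : ι → ℤ} (hx : A.mulVec x = 0) (hle : ∀ i, |x i| ≤ |g i|) :
    x = 0 ∨ ∀ i, |x i| = |g i| := by
  by_cases h0 : x = 0
  · exact Or.inl h0
  · refine Or.inr fun i => ?_
    have h := le_antisymm (Finset.sum_le_sum fun i _ => hle i) (hmin x hx h0)
    exact (Finset.sum_eq_sum_iff_of_le fun i _ => hle i).1 h i (Finset.mem_univ i)

/-- The coefficients `b`, `c` of the columns of `[[A, A], [H, -H]]` in a sum inside the box are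
trivial or maximal. -/
theorem sum_abs_of_mem_box {R ι : Type*} [Fintype ι] [DecidableEq ι] {A : Matrix R ι ℤ}
    {H : Matrix ι ι ℤ}
    (hA : ∀ r i, A r i = 1 ∨ A r i = -1) (hH : ∀ r i, H r i = 1 ∨ H r i = -1)
    (hHsq : ∀ x : ι → ℤ, ∑ j, (H.mulVec x) j ^ 2 = Fintype.card ι * ∑ i, x i ^ 2)
    {g : ι → ℤ}
    (hmin : ∀ x, A.mulVec x = 0 → x ≠ 0 → ∑ i, |g i| ≤ ∑ i, |x i|)
    {i₀ : ι} {b c : ι → ℤ} (hb : ∀ i, |b i| ≤ |g i|) (hc : ∀ i, |c i| ≤ |g i|)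
    (hc₀ : |c i₀| < |g i₀|)
    (hAbox : ∀ r, |(A.mulVec b) r + (A.mulVec c) r| ≤ 1)
    (hHbox : ∀ j, |(H.mulVec b) j - (H.mulVec c) j| ≤ 1) :
    ∑ i, |b i| + ∑ i, |c i| ≤ 1 ∨ 2 * ∑ i, |g i| - 1 ≤ ∑ i, |b i| + ∑ i, |c i| := by
  have hpos : 0 < (Fintype.card ι : ℤ) := by
    have : Nonempty ι := ⟨i₀⟩
    exact_mod_cast Fintype.card_pos
  have hcker : A.mulVec c = 0 → c = 0 := fun h =>
    (eq_zero_or_abs_eq_of_mulVec_eq_zero hmin h hc).resolve_right fun h' => hc₀.ne (h' i₀)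
  have pb := two_dvd_sum_abs_sub_sum b
  have pc := two_dvd_sum_abs_sub_sum c
  rcases Int.even_or_odd (∑ i, b i + ∑ i, c i) with hev | hodd
  · have hHz : H.mulVec (b - c) = 0 := by
      funext j
      have h1 := two_dvd_mulVec_sub_sum H hH b j
      have h2 := two_dvd_mulVec_sub_sum H hH c j
      have h3 := abs_le.1 (hHbox j)
      rw [Matrix.mulVec_sub, Pi.sub_apply, Pi.zero_apply]
      obtain ⟨z, hz⟩ := hev
      omega
    have hbc : b = c := by
      have h := hHsq (b - c)
      rw [hHz] at h
      have h0 : ∑ i, (b - c) i ^ 2 = 0 := by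
        rcases mul_eq_zero.1 (h.symm.trans (by simp)) with h' | h'
        · omega
        · exact h'
      funext i
      have := (Finset.sum_eq_zero_iff_of_nonneg (fun i _ => sq_nonneg ((b - c) i))).1 h0 i
        (Finset.mem_univ i)
      exact sub_eq_zero.1 (pow_eq_zero_iff two_ne_zero |>.1 this)
    subst hbc
    have hAz : A.mulVec b = 0 := by
      funext r
      have := abs_le.1 (hAbox r)
      simp only [Pi.zero_apply]
      omega
    left
    simp [hcker hAz]
  · have hHone : ∀ j, (H.mulVec (b - c)) j ^ 2 = 1 := by
      intro j
      have h1 := two_dvd_mulVec_sub_sum H hH b j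
      have h2 := two_dvd_mulVec_sub_sum H hH c j
      have h3 := abs_le.1 (hHbox j)
      obtain ⟨z, hz⟩ := hodd
      have : (H.mulVec (b - c)) j = 1 ∨ (H.mulVec (b - c)) j = -1 := by
        rw [Matrix.mulVec_sub, Pi.sub_apply]
        omega
      rcases this with h | h <;> rw [h] <;> norm_num
    have hsq : ∑ i, (b - c) i ^ 2 = 1 := by
      have h := hHsq (b - c)
      simp only [hHone, Finset.sum_const, Finset.card_univ, nsmul_eq_mul, mul_one] at h
      exact mul_left_cancel₀ hpos.ne' (by rw [← h, mul_one])
    obtain ⟨k, δ, hδ, hk⟩ := exists_eq_single_of_sum_sq_eq_one _ hsq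
    have hdiff : ∀ r, (A.mulVec b) r - (A.mulVec c) r = A r k * δ := by
      intro r
      rw [← Pi.sub_apply, ← Matrix.mulVec_sub, hk, Matrix.mulVec_single]
      simp
    have hunit : ∀ r, A r k * δ = 1 ∨ A r k * δ = -1 := by
      intro r
      rcases hA r k with h | h <;> rcases hδ with h' | h' <;> simp [h, h']
    have hsingle : ∑ i, |(Pi.single k δ : ι → ℤ) i| = 1 := by
      rw [Finset.sum_eq_single k (fun i _ hi => by simp [hi]) (by simp)]
      rcases hδ with h | h <;> simp [h]
    have hle : ∀ x y : ι → ℤ, (∀ i, |(x - y) i| = |(Pi.single k δ : ι → ℤ) i|) →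
        ∑ i, |x i| ≤ ∑ i, |y i| + 1 := by
      intro x y hxy
      rw [← hsingle, ← Finset.sum_add_distrib]
      refine Finset.sum_le_sum fun i _ => ?_
      rw [← hxy i, Pi.sub_apply]
      have := abs_add_le (y i) (x i - y i)
      simpa using this
    have hbc := hle b c fun i => by rw [hk]
    have hcb := hle c b fun i => by rw [← hk, Pi.sub_apply, Pi.sub_apply, abs_sub_comm]
    rcases Int.even_or_odd (∑ i, b i) with hbe | hbo
    · have hAz : A.mulVec b = 0 := by
        funext r
        have h1 := two_dvd_mulVec_sub_sum A hA b r
        have h3 := abs_le.1 (hAbox r)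
        have h4 := hdiff r
        have h5 := hunit r
        obtain ⟨z, hz⟩ := hbe
        simp only [Pi.zero_apply]
        omega
      rcases eq_zero_or_abs_eq_of_mulVec_eq_zero hmin hAz hb with h | h
      · subst h
        left
        simpa using hcb
      · right
        simp only [h] at hbc ⊢
        omega
    · have hAz : A.mulVec c = 0 := by
        funext r
        have h1 := two_dvd_mulVec_sub_sum A hA c r
        have h3 := abs_le.1 (hAbox r)
        have h4 := hdiff r
        have h5 := hunit r
        obtain ⟨z, hz⟩ := hbo
        obtain ⟨w, hw⟩ := hodd
        simp only [Pi.zero_apply]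
        omega
      have := hcker hAz
      subst this
      left
      simpa using hbc

/-- A shortest integer kernel vector of a `±1` matrix gives a minimal box sequence of `±1` vectors,
in a dimension enlarged by the order of a Hadamard matrix. -/
theorem two_mul_sum_natAbs_sub_one_mem_pmLengths {R ι : Type*} [Fintype ι] [DecidableEq ι]
    {A : Matrix R ι ℤ} {H : Matrix ι ι ℤ}
    (hA : ∀ r i, A r i = 1 ∨ A r i = -1) (hH : ∀ r i, H r i = 1 ∨ H r i = -1)
    (hHsq : ∀ x : ι → ℤ, ∑ j, (H.mulVec x) j ^ 2 = Fintype.card ι * ∑ i, x i ^ 2)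
    {g : ι → ℤ} (hg : A.mulVec g = 0) (hg0 : g ≠ 0)
    (hmin : ∀ x, A.mulVec x = 0 → x ≠ 0 → ∑ i, |g i| ≤ ∑ i, |x i|)
    {d : ℕ} (e : Fin d ≃ R ⊕ ι) :
    2 * ∑ i, (g i).natAbs - 1 ∈ pmLengths d := by
  obtain ⟨i₀, hi₀⟩ : ∃ i, g i ≠ 0 := by
    by_contra! h
    exact hg0 (funext h)
  let σ : ι → ℤ := fun i => if 0 ≤ g i then 1 else -1
  have hσ : ∀ i, σ i = 1 ∨ σ i = -1 := fun i => by
    by_cases h : 0 ≤ g i <;> simp [σ, h]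
  have hσabs : ∀ i (n : ℕ), |σ i * n| = n := fun i n => by
    rcases hσ i with h | h <;> simp [h]
  have hσg : ∀ i, σ i * ((g i).natAbs : ℕ) = g i := fun i => by
    by_cases h : 0 ≤ g i <;> simp only [σ, h, if_true, if_false] <;> omega
  let μ : ι × Bool → ℕ := fun p =>
    if p.2 then (g p.1).natAbs else (g p.1).natAbs - (if p.1 = i₀ then 1 else 0)
  let V : ι × Bool → R ⊕ ι → ℤ := fun p =>
    Sum.elim (fun r => σ p.1 * A r p.1) (fun j => (if p.2 then 1 else -1) * (σ p.1 * H j p.1))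
  have hV : ∀ p x, V p x = 1 ∨ V p x = -1 := by
    rintro ⟨i, s⟩ (r | j)
    · rcases hσ i with h | h <;> rcases hA r i with h' | h' <;> simp [V, h, h']
    · rcases hσ i with h | h <;> rcases hH j i with h' | h' <;> cases s <;> simp [V, h, h']
  have hμ : ∑ p, μ p = 2 * ∑ i, (g i).natAbs - 1 := by
    have h1 : ∑ i, μ (i, false) + 1 = ∑ i, (g i).natAbs := by
      have h2 : (1 : ℕ) = ∑ i, if i = i₀ then 1 else 0 := by simp
      rw [h2, ← Finset.sum_add_distrib]
      refine Finset.sum_congr rfl fun i _ => ?_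
      by_cases h : i = i₀
      · subst h; simp [μ]; omega
      · simp [μ, h]
    have h3 : ∑ i, μ (i, true) = ∑ i, (g i).natAbs := by simp [μ]
    rw [Fintype.sum_prod_type]
    simp only [Fintype.sum_bool, Finset.sum_add_distrib]
    omega
  set t := 2 * ∑ i, (g i).natAbs - 1 with ht
  obtain ⟨φ, hφ⟩ := exists_fin_fiber_card μ hμ
  let cnt : Finset (Fin t) → ι × Bool → ℕ := fun S p => (S.filter (fun k => φ k = p)).card
  have hcnt_le : ∀ S p, cnt S p ≤ μ p := fun S p => by
    rw [← hφ p]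
    exact Finset.card_le_card (Finset.filter_subset_filter _ (Finset.subset_univ S))
  have hcnt_univ : ∀ p, cnt Finset.univ p = μ p := hφ
  let B : Finset (Fin t) → ι → ℤ := fun S i => σ i * cnt S (i, true)
  let C : Finset (Fin t) → ι → ℤ := fun S i => σ i * cnt S (i, false)
  have hsum : ∀ S x, ∑ k ∈ S, V (φ k) x = ∑ p, cnt S p * V p x := by
    intro S x
    rw [← Finset.sum_fiberwise S φ]
    refine Finset.sum_congr rfl fun p _ => ?_
    rw [Finset.sum_congr rfl fun k hk => by rw [(Finset.mem_filter.1 hk).2], Finset.sum_const,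
      nsmul_eq_mul]
  have hcard : ∀ S : Finset (Fin t), (S.card : ℤ) = ∑ i, |B S i| + ∑ i, |C S i| := by
    intro S
    have h : S.card = ∑ p, cnt S p :=
      Finset.card_eq_sum_card_fiberwise fun k _ => Finset.mem_coe.2 (Finset.mem_univ (φ k))
    rw [h, Fintype.sum_prod_type]
    simp only [B, C, hσabs, Fintype.sum_bool, Finset.sum_add_distrib, Nat.cast_add, Nat.cast_sum]
  have hinl : ∀ S r, ∑ k ∈ S, V (φ k) (Sum.inl r) = (A.mulVec (B S)) r + (A.mulVec (C S)) r := by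
    intro S r
    rw [hsum, Fintype.sum_prod_type]
    simp only [Fintype.sum_bool, V, Sum.elim_inl, Matrix.mulVec, dotProduct, B, C,
      ← Finset.sum_add_distrib]
    exact Finset.sum_congr rfl fun i _ => by ring
  have hinr : ∀ S j, ∑ k ∈ S, V (φ k) (Sum.inr j) = (H.mulVec (B S)) j - (H.mulVec (C S)) j := by
    intro S j
    rw [hsum, Fintype.sum_prod_type]
    simp only [Fintype.sum_bool, V, Sum.elim_inr, Matrix.mulVec, dotProduct, B, C,
      ← Finset.sum_sub_distrib]
    exact Finset.sum_congr rfl fun i _ => by simp; ring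
  let v : Fin t → Fin d → ℝ := fun k j => (V (φ k) (e j) : ℝ)
  have hbox : ∀ S : Finset (Fin t), ∑ k ∈ S, v k ∈ unitBox d ↔
      ∀ x, |∑ k ∈ S, V (φ k) x| ≤ 1 := by
    intro S
    rw [← e.forall_congr_right]
    refine forall_congr' fun j => ?_
    rw [Finset.sum_apply, abs_le]
    simp only [v]
    norm_cast
  refine ⟨v, fun k j => ?_, ?_, ?_, ?_⟩
  · rcases hV (φ k) (e j) with h | h <;> simp [v, h]
  · intro k j
    rcases hV (φ k) (e j) with h | h <;> simp [v, h]
  · have hB : B Finset.univ = g := by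
      funext i
      simpa [B, hcnt_univ, μ] using hσg i
    have hC : C Finset.univ = g - Pi.single i₀ (σ i₀) := by
      funext i
      simp only [C, hcnt_univ, μ, Pi.sub_apply]
      by_cases h : i = i₀
      · subst h
        have hpos : 1 ≤ (g i).natAbs := by omega
        simp only [if_true, Pi.single_eq_same, Bool.false_eq_true, if_false]
        rw [Nat.cast_sub hpos, mul_sub, hσg]
        simp
      · simpa [h] using hσg i
    rw [hbox]
    rintro (r | j)
    · rw [hinl, hB, hC, Matrix.mulVec_sub, hg, Matrix.mulVec_single]
      rcases hσ i₀ with h | h <;> rcases hA r i₀ with h' | h' <;> simp [h, h']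
    · rw [hinr, hB, hC, Matrix.mulVec_sub, Matrix.mulVec_single]
      rcases hσ i₀ with h | h <;> rcases hH j i₀ with h' | h' <;> simp [h, h']
  · intro S h2 hlt hS
    rw [hbox] at hS
    have hle : ∀ i s, cnt S (i, s) ≤ (g i).natAbs := fun i s =>
      (hcnt_le S (i, s)).trans (by cases s <;> simp [μ])
    have key := sum_abs_of_mem_box (i₀ := i₀) (b := B S) (c := C S) hA hH hHsq hmin
      (fun i => by simp only [B, hσabs]; rw [Int.abs_eq_natAbs]; exact_mod_cast hle i true)
      (fun i => by simp only [C, hσabs]; rw [Int.abs_eq_natAbs]; exact_mod_cast hle i false)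
      (by
        simp only [C, hσabs]
        have := hcnt_le S (i₀, false)
        simp only [μ, if_true, Bool.false_eq_true, if_false] at this
        rw [Int.abs_eq_natAbs]
        omega)
      (fun r => by rw [← hinl]; exact hS _) (fun j => by rw [← hinr]; exact hS _)
    rw [← hcard] at key
    have habs : ∑ i, |g i| = ((∑ i, (g i).natAbs : ℕ) : ℤ) := by
      push_cast
      simp
    rw [habs] at key
    omega

/-- The character `χ_β(y) = (-1)^{|β ∩ y|}` of the group of finite sets under symmetric
difference. -/
def setChar (β y : Finset ℕ) : ℤ := ∏ c ∈ β, if c ∈ y then -1 else 1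

theorem setChar_eq_one_or (β y : Finset ℕ) : setChar β y = 1 ∨ setChar β y = -1 := by
  unfold setChar
  refine Finset.prod_induction _ (fun z : ℤ => z = 1 ∨ z = -1) ?_ (Or.inl rfl) ?_
  · rintro a b (rfl | rfl) (rfl | rfl) <;> simp
  · intro c _
    by_cases h : c ∈ y <;> simp [h]

theorem setChar_mul_self (β y : Finset ℕ) : setChar β y * setChar β y = 1 := by
  rcases setChar_eq_one_or β y with h | h <;> simp [h]

@[simp] theorem setChar_empty (y : Finset ℕ) : setChar ∅ y = 1 := by simp [setChar]

theorem setChar_union {β γ : Finset ℕ} (h : Disjoint β γ) (y : Finset ℕ) :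
    setChar (β ∪ γ) y = setChar β y * setChar γ y :=
  Finset.prod_union h

theorem setChar_comm (β y : Finset ℕ) : setChar β y = setChar y β := by
  have h : ∀ s t : Finset ℕ, setChar s t = (-1) ^ (s ∩ t).card := by
    intro s t
    rw [setChar, Finset.prod_ite]
    simp [Finset.filter_mem_eq_inter]
  rw [h, h, Finset.inter_comm]

theorem setChar_mul_setChar_union {P q α : Finset ℕ} (hq : q ⊆ P) (hα : Disjoint P α)
    (y : Finset ℕ) : setChar q y * setChar (P ∪ α) y = setChar ((P \ q) ∪ α) y := by
  have hP : P = q ∪ (P \ q) := (Finset.union_sdiff_of_subset hq).symm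
  have hd : Disjoint (P \ q) α := hα.mono_left Finset.sdiff_subset
  rw [setChar_union hα, setChar_union hd]
  conv_lhs => rw [hP]
  rw [setChar_union Finset.disjoint_sdiff, ← mul_assoc, ← mul_assoc, setChar_mul_self, one_mul]

theorem sum_powerset_setChar_mul (P s y : Finset ℕ) :
    ∑ q ∈ P.powerset, setChar q s * setChar q y =
      if P ∩ y = P ∩ s then 2 ^ P.card else 0 := by
  simp only [setChar, ← Finset.prod_mul_distrib]
  rw [← Finset.prod_one_add]
  split_ifs with h
  · rw [← Finset.prod_const]
    refine Finset.prod_congr rfl fun c hc => ?_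
    have : c ∈ y ↔ c ∈ s := by
      have := Finset.ext_iff.1 h c
      simpa [hc] using this
    by_cases hs : c ∈ s <;> simp [this, hs]
  · obtain ⟨c, hc⟩ : ∃ c, ¬(c ∈ P ∩ y ↔ c ∈ P ∩ s) := by
      by_contra! h'
      exact h (Finset.ext h')
    have hcP : c ∈ P := by
      by_contra h'
      simp [h'] at hc
    refine Finset.prod_eq_zero hcP ?_
    by_cases hs : c ∈ s <;> by_cases hy : c ∈ y <;> simp_all

theorem sum_powerset_setChar {P q : Finset ℕ} (hq : q ⊆ P) (hne : q ≠ ∅) :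
    ∑ s ∈ P.powerset, setChar q s = 0 := by
  have h := sum_powerset_setChar_mul P ∅ q
  rw [if_neg] at h
  · simpa [setChar_comm _ q, setChar_comm _ ∅] using h
  · rw [Finset.inter_eq_right.2 hq]
    simpa using hne

/-- Some character makes a sum over the nontrivial characters have a prescribed sign. -/
theorem exists_mul_sum_setChar_nonpos (P : Finset ℕ) (r : ℤ) (w : Finset ℕ → ℤ) :
    ∃ s, r * ∑ q ∈ P.powerset.erase ∅, setChar q s * w q ≤ 0 := by
  by_contra! h
  have hpos : 0 < ∑ s ∈ P.powerset, r * ∑ q ∈ P.powerset.erase ∅, setChar q s * w q :=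
    Finset.sum_pos (fun s _ => h s) ⟨∅, Finset.empty_mem_powerset P⟩
  rw [← Finset.mul_sum, Finset.sum_comm, Finset.sum_eq_zero, mul_zero] at hpos
  · exact hpos.false
  · intro q hq
    rw [Finset.mem_erase, Finset.mem_powerset] at hq
    rw [← Finset.sum_mul, sum_powerset_setChar hq.2 hq.1, zero_mul]

/-- The Walsh transform of a function on the subsets of `{0, …, m - 1}`. -/
def walsh {m : ℕ} (g : (Finset.range m).powerset → ℤ) (β : Finset ℕ) : ℤ :=
  ∑ y : (Finset.range m).powerset, setChar β y * g y

/-- A `±1` function that agrees with `χ_α`, except on a subcube, where it agrees with `-χ_β`. -/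
def cubeFlip (P s α β y : Finset ℕ) : ℤ :=
  if P ∩ y = P ∩ s then -setChar β y else setChar α y

theorem cubeFlip_eq_one_or (P s α β y : Finset ℕ) :
    cubeFlip P s α β y = 1 ∨ cubeFlip P s α β y = -1 := by
  unfold cubeFlip
  rcases setChar_eq_one_or α y with h | h <;> rcases setChar_eq_one_or β y with h' | h' <;>
    split_ifs <;> simp [h, h']

theorem two_pow_mul_cubeFlip {P α β : Finset ℕ} (hα : Disjoint P α) (hβ : Disjoint P β)
    (s y : Finset ℕ) :
    2 ^ P.card * cubeFlip P s (P ∪ α) (P ∪ β) y = 2 ^ P.card * setChar (P ∪ α) y -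
      ∑ q ∈ P.powerset, setChar q s *
        (setChar ((P \ q) ∪ α) y + setChar ((P \ q) ∪ β) y) := by
  have h : ∑ q ∈ P.powerset, setChar q s *
      (setChar ((P \ q) ∪ α) y + setChar ((P \ q) ∪ β) y) =
      (∑ q ∈ P.powerset, setChar q s * setChar q y) *
        (setChar (P ∪ α) y + setChar (P ∪ β) y) := by
    rw [Finset.sum_mul]
    refine Finset.sum_congr rfl fun q hq => ?_
    rw [Finset.mem_powerset] at hq
    rw [← setChar_mul_setChar_union hq hα, ← setChar_mul_setChar_union hq hβ]
    ring
  rw [h, sum_powerset_setChar_mul, cubeFlip]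
  split_ifs <;> ring

theorem walsh_eq_of_sum_cubeFlip_eq_zero {m : ℕ} {g : (Finset.range m).powerset → ℤ}
    {P α β s : Finset ℕ} (hα : Disjoint P α) (hβ : Disjoint P β)
    (h : ∑ y : (Finset.range m).powerset, cubeFlip P s (P ∪ α) (P ∪ β) y * g y = 0) :
    walsh g (P ∪ β) = (2 ^ P.card - 1) * walsh g (P ∪ α) -
      ∑ q ∈ P.powerset.erase ∅, setChar q s *
        (walsh g ((P \ q) ∪ α) + walsh g ((P \ q) ∪ β)) := by
  have h1 : 2 ^ P.card * walsh g (P ∪ α) = ∑ q ∈ P.powerset, setChar q s *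
      (walsh g ((P \ q) ∪ α) + walsh g ((P \ q) ∪ β)) := by
    rw [← sub_eq_zero, ← mul_zero (2 ^ P.card : ℤ), ← h]
    simp only [walsh, ← Finset.sum_add_distrib, Finset.mul_sum]
    rw [Finset.sum_comm, ← Finset.sum_sub_distrib]
    refine Finset.sum_congr rfl fun y _ => ?_
    rw [← mul_assoc (2 ^ P.card) (cubeFlip _ _ _ _ _), two_pow_mul_cubeFlip hα hβ, sub_mul,
      Finset.sum_mul, mul_assoc]
    congr 1
    exact Finset.sum_congr rfl fun q _ => by ring
  rw [← Finset.add_sum_erase _ _ (Finset.empty_mem_powerset P)] at h1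
  simp only [setChar_empty, Finset.sdiff_empty, one_mul] at h1
  linarith

theorem sum_walsh_sq {m : ℕ} (g : (Finset.range m).powerset → ℤ) :
    ∑ β : (Finset.range m).powerset, walsh g β ^ 2 =
      Fintype.card (Finset.range m).powerset * ∑ y, g y ^ 2 := by
  have h : ∀ y z : (Finset.range m).powerset,
      ∑ β : (Finset.range m).powerset, setChar β y * setChar β z =
        if z = y then (Fintype.card (Finset.range m).powerset : ℤ) else 0 := by
    intro y z
    rw [Finset.sum_coe_sort (Finset.range m).powerset fun β => setChar β y * setChar β z,
      sum_powerset_setChar_mul, Finset.inter_eq_right.2 (Finset.mem_powerset.1 y.2),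
      Finset.inter_eq_right.2 (Finset.mem_powerset.1 z.2)]
    rw [Fintype.card_coe, Finset.card_powerset, Finset.card_range]
    by_cases hzy : z = y
    · rw [if_pos hzy, if_pos (congrArg Subtype.val hzy)]
      norm_cast
    · rw [if_neg hzy, if_neg fun h => hzy (Subtype.ext h)]
  calc ∑ β : (Finset.range m).powerset, walsh g β ^ 2
      = ∑ β : (Finset.range m).powerset, ∑ y, ∑ z : (Finset.range m).powerset,
          (g y * g z) * (setChar β y * setChar β z) := by
        refine Finset.sum_congr rfl fun β _ => ?_
        rw [sq, walsh, Finset.sum_mul_sum]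
        exact Finset.sum_congr rfl fun y _ => Finset.sum_congr rfl fun z _ => by ring
    _ = ∑ y, ∑ z, (g y * g z) * ∑ β : (Finset.range m).powerset, setChar β y * setChar β z := by
        rw [Finset.sum_comm]
        refine Finset.sum_congr rfl fun y _ => ?_
        rw [Finset.sum_comm]
        exact Finset.sum_congr rfl fun z _ => by rw [Finset.mul_sum]
    _ = _ := by
        simp only [h]
        rw [Finset.mul_sum]
        refine Finset.sum_congr rfl fun y _ => ?_
        simp
        ring

/-- The number whose binary digits one are at the positions in `β`. -/
def binVal (β : Finset ℕ) : ℕ := ∑ c ∈ β, 2 ^ c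

theorem binVal_injective : Function.Injective binVal := Finset.geomSum_injective le_rfl

theorem binVal_union {β γ : Finset ℕ} (h : Disjoint β γ) :
    binVal (β ∪ γ) = binVal β + binVal γ :=
  Finset.sum_union h

@[simp] theorem binVal_singleton (c : ℕ) : binVal {c} = 2 ^ c := by simp [binVal]

theorem binVal_range_add_one (c : ℕ) : binVal (Finset.range c) + 1 = 2 ^ c := by
  induction c with
  | zero => simp [binVal]
  | succ c ih =>
    rw [binVal, Finset.sum_range_succ, ← binVal, pow_succ]
    omega

theorem binVal_mono {β γ : Finset ℕ} (h : β ⊆ γ) : binVal β ≤ binVal γ :=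
  Finset.sum_le_sum_of_subset h

theorem binVal_lt_two_pow_iff {β : Finset ℕ} {m : ℕ} :
    binVal β < 2 ^ m ↔ β ⊆ Finset.range m := by
  constructor
  · intro h c hc
    rw [Finset.mem_range]
    have h1 := binVal_mono (Finset.singleton_subset_iff.2 hc)
    rw [binVal_singleton] at h1
    exact (Nat.pow_lt_pow_iff_right (by norm_num)).1 (h1.trans_lt h)
  · intro h
    have h1 := binVal_mono h
    have h2 := binVal_range_add_one m
    omega

/-- A splitting `β = P ∪ b` with a predecessor `P ∪ a` of `β` in the binary order, such that the
sets `q ∪ a` and `q ∪ b` with `q ⊂ P` precede `β` too. The sets between `β` and its predecessor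
have at most one element. -/
structure IsBinarySplitting (β P a b : Finset ℕ) : Prop where
  eq_union : β = P ∪ b
  disjoint_left : Disjoint P a
  disjoint_right : Disjoint P b
  card_add_one : P.card + 1 = β.card
  two_le_card : 2 ≤ (P ∪ a).card
  left_lt : ∀ q ⊆ P, binVal (q ∪ a) < binVal β
  right_lt : ∀ q ⊂ P, binVal (q ∪ b) < binVal β
  gap : ∀ γ : Finset ℕ, 2 ≤ γ.card → binVal γ < binVal β → binVal γ ≤ binVal (P ∪ a)

theorem isBinarySplitting_erase_min {β : Finset ℕ} (hne : β.Nonempty)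
    (h : 2 ≤ (β.erase (β.min' hne) ∪ Finset.range (β.min' hne)).card) :
    IsBinarySplitting β (β.erase (β.min' hne)) (Finset.range (β.min' hne)) {β.min' hne} := by
  set c := β.min' hne with hc
  have hcβ : c ∈ β := β.min'_mem hne
  have hlt : ∀ e ∈ β.erase c, c < e := fun e he =>
    lt_of_le_of_ne (β.min'_le e (Finset.mem_of_mem_erase he)) (Finset.ne_of_mem_erase he).symm
  have hdl : Disjoint (β.erase c) (Finset.range c) :=
    Finset.disjoint_left.2 fun e he he' => (hlt e he).not_gt (Finset.mem_range.1 he')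
  have hdr : Disjoint (β.erase c) {c} := by simp
  have heq : β = β.erase c ∪ {c} := by
    rw [Finset.union_comm, ← Finset.insert_eq, Finset.insert_erase hcβ]
  have hval : binVal β = binVal (β.erase c) + 2 ^ c := by
    conv_lhs => rw [heq]
    rw [binVal_union hdr, binVal_singleton]
  have hrange := binVal_range_add_one c
  refine ⟨heq, hdl, hdr, Finset.card_erase_add_one hcβ, h, ?_, ?_, ?_⟩
  · intro q hq
    rw [binVal_union (hdl.mono_left hq)]
    have := binVal_mono hq
    omega
  · intro q hq
    rw [binVal_union (hdr.mono_left hq.subset), binVal_singleton]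
    obtain ⟨e, heP, heq⟩ := Finset.exists_of_ssubset hq
    have h1 := binVal_mono (Finset.union_subset hq.subset (Finset.singleton_subset_iff.2 heP))
    rw [binVal_union (by simpa using heq), binVal_singleton] at h1
    have h2 : 0 < 2 ^ e := by positivity
    omega
  · intro γ _ hγ
    rw [binVal_union hdl]
    omega

theorem isBinarySplitting_pair {k : ℕ} (hk : 2 ≤ k) :
    IsBinarySplitting {0, k} {0} (Finset.Ioo 0 k) {k} := by
  have hrange : {0} ∪ Finset.Ioo 0 k = Finset.range k := by
    ext e
    simp
    omega
  have hval : binVal {0, k} = 1 + 2 ^ k := by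
    rw [Finset.insert_eq, binVal_union (by simp; omega)]
    simp
  have h1 := binVal_range_add_one k
  refine ⟨rfl, by simp, by simp; omega, ?_, ?_, ?_, ?_, ?_⟩
  · rw [Finset.card_pair (by omega), Finset.card_singleton]
  · rwa [hrange, Finset.card_range]
  · intro q hq
    have h2 := binVal_mono (Finset.union_subset_union hq (Finset.Subset.refl (Finset.Ioo 0 k)))
    rw [hrange] at h2
    omega
  · intro q hq
    rw [Finset.ssubset_singleton_iff.1 hq, hval]
    simp
  · intro γ hγ hlt
    rw [hrange]
    have h2 : binVal γ ≠ 2 ^ k := by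
      rw [← binVal_singleton]
      intro h
      rw [binVal_injective h] at hγ
      simp at hγ
    omega

theorem exists_isBinarySplitting {β : Finset ℕ} (hβ : 2 ≤ β.card) (hne : β ≠ {0, 1}) :
    ∃ P a b, IsBinarySplitting β P a b := by
  have hne' : β.Nonempty := Finset.card_pos.1 (by omega)
  by_cases h : 2 ≤ (β.erase (β.min' hne') ∪ Finset.range (β.min' hne')).card
  · exact ⟨_, _, _, isBinarySplitting_erase_min hne' h⟩
  · set c := β.min' hne' with hc
    have hcβ : c ∈ β := β.min'_mem hne'
    have hdl : Disjoint (β.erase c) (Finset.range c) :=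
      Finset.disjoint_left.2 fun e he he' => (β.min'_le e (Finset.mem_of_mem_erase he)).not_gt
        (Finset.mem_range.1 he')
    rw [Finset.card_union_of_disjoint hdl, Finset.card_range, Finset.card_erase_of_mem hcβ] at h
    have hc0 : c = 0 := by omega
    obtain ⟨x, y, hxy, rfl⟩ := Finset.card_eq_two.1 (show β.card = 2 by omega)
    rw [hc0] at hcβ
    obtain ⟨k, hk0, hk⟩ : ∃ k, k ≠ 0 ∧ ({x, y} : Finset ℕ) = {0, k} := by
      rw [Finset.mem_insert, Finset.mem_singleton] at hcβ
      rcases hcβ with rfl | rfl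
      · exact ⟨y, hxy.symm, rfl⟩
      · exact ⟨x, hxy, Finset.pair_comm _ _⟩
    have hk1 : k ≠ 1 := by
      rintro rfl
      exact hne hk
    rw [hk]
    exact ⟨_, _, _, isBinarySplitting_pair (by omega)⟩

/-- Strong recursion along a measure, with a choice at each step. -/
theorem exists_forall_of_measure {T V : Type*} [Inhabited V] (v : T → ℕ)
    (r : T → (T → V) → V → Prop) (hex : ∀ t f, ∃ x, r t f x)
    (hcongr : ∀ t f f' x, (∀ u, v u < v t → f u = f' u) → r t f x → r t f' x) :
    ∃ X : T → V, ∀ t, r t X (X t) := by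
  classical
  choose F hF using hex
  let step : ∀ t, (∀ u, v u < v t → V) → V := fun t ih =>
    F t fun u => if h : v u < v t then ih u h else default
  let X : T → V := (measure v).wf.fix step
  have hX : ∀ t, X t = F t fun u => if v u < v t then X u else default := by
    intro t
    have := (measure v).wf.fix_eq step t
    refine this.trans ?_
    simp only [step]
    congr 1
  refine ⟨X, fun t => ?_⟩
  rw [hX t]
  refine hcongr t _ _ _ (fun u hu => ?_) (hF t _)
  simp [hu]

/-- The right-hand side of the recursion for the Walsh transform of a kernel vector. -/
def walshStep (P a b s : Finset ℕ) (f : Finset ℕ → ℤ) : ℤ :=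
  (2 ^ P.card - 1) * f (P ∪ a) -
    ∑ q ∈ P.powerset.erase ∅, setChar q s * (f ((P \ q) ∪ a) + f ((P \ q) ∪ b))

theorem IsBinarySplitting.walshStep_congr {β P a b : Finset ℕ} (h : IsBinarySplitting β P a b)
    (s : Finset ℕ) {f f' : Finset ℕ → ℤ} (hf : ∀ γ, binVal γ < binVal β → f γ = f' γ) :
    walshStep P a b s f = walshStep P a b s f' := by
  unfold walshStep
  rw [hf _ (h.left_lt P (Finset.Subset.refl P))]
  congr 1
  refine Finset.sum_congr rfl fun q hq => ?_
  rw [Finset.mem_erase, Finset.mem_powerset] at hq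
  rw [hf _ (h.left_lt _ Finset.sdiff_subset),
    hf _ (h.right_lt _ (Finset.sdiff_ssubset hq.2 (Finset.nonempty_iff_ne_empty.2 hq.1)))]

theorem walshStep_mul (P a b s : Finset ℕ) (f : Finset ℕ → ℤ) (r : ℤ) :
    walshStep P a b s (fun γ => f γ * r) = walshStep P a b s f * r := by
  unfold walshStep
  rw [sub_mul _ _ r, Finset.sum_mul]
  congr 1
  · ring
  · exact Finset.sum_congr rfl fun q _ => by ring

theorem exists_le_abs_walshStep (P a b : Finset ℕ) (f : Finset ℕ → ℤ) :
    ∃ s, (2 ^ P.card - 1) * |f (P ∪ a)| ≤ |walshStep P a b s f| := by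
  obtain ⟨s, hs⟩ := exists_mul_sum_setChar_nonpos P (f (P ∪ a))
    fun q => f ((P \ q) ∪ a) + f ((P \ q) ∪ b)
  refine ⟨s, ?_⟩
  unfold walshStep
  have hk : (0 : ℤ) ≤ 2 ^ P.card - 1 := by
    have := one_le_pow₀ (n := P.card) (show (1 : ℤ) ≤ 2 by norm_num)
    omega
  generalize (2 ^ P.card - 1 : ℤ) = k at hk
  generalize ∑ q ∈ P.powerset.erase ∅, setChar q s * (f ((P \ q) ∪ a) + f ((P \ q) ∪ b)) = w at hs
  generalize f (P ∪ a) = z at hs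
  rcases lt_trichotomy z 0 with hz | rfl | hz
  · have hw : 0 ≤ w := by
      by_contra! hw
      exact (mul_pos_of_neg_of_neg hz hw).not_ge hs
    rw [abs_of_neg hz, abs_of_nonpos (by nlinarith)]
    linarith
  · simp
  · have hw : w ≤ 0 := by
      by_contra! hw
      exact (mul_pos hz hw).not_ge hs
    rw [abs_of_pos hz]
    exact le_trans (by linarith) (le_abs_self _)

/-- The data of a Håstad matrix: splittings and signs, together with the normalized Walsh transform
`X` of a kernel vector. -/
structure IsHastadData (P a b s : Finset ℕ → Finset ℕ) (X : Finset ℕ → ℤ) : Prop where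
  split : ∀ β : Finset ℕ, 2 ≤ β.card → β ≠ {0, 1} → IsBinarySplitting β (P β) (a β) (b β)
  eq_zero : ∀ β : Finset ℕ, β.card ≤ 1 → X β = 0
  pair : X {0, 1} = 1
  step : ∀ β : Finset ℕ, 2 ≤ β.card → β ≠ {0, 1} → X β = walshStep (P β) (a β) (b β) (s β) X
  growth : ∀ β : Finset ℕ, 2 ≤ β.card → β ≠ {0, 1} →
    (2 ^ (P β).card - 1) * |X (P β ∪ a β)| ≤ |X β|

theorem exists_isHastadData : ∃ P a b s X, IsHastadData P a b s X := by
  have hsplit : ∀ β : Finset ℕ, ∃ P a b, 2 ≤ β.card → β ≠ {0, 1} → IsBinarySplitting β P a b := by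
    intro β
    by_cases h : 2 ≤ β.card ∧ β ≠ {0, 1}
    · obtain ⟨P, a, b, hP⟩ := exists_isBinarySplitting h.1 h.2
      exact ⟨P, a, b, fun _ _ => hP⟩
    · exact ⟨∅, ∅, ∅, fun h1 h2 => absurd ⟨h1, h2⟩ h⟩
  choose P a b hP using hsplit
  obtain ⟨X, hX⟩ := exists_forall_of_measure binVal
    (fun (β : Finset ℕ) (f : Finset ℕ → ℤ) (x : ℤ) => (β.card ≤ 1 → x = 0) ∧ (β = {0, 1} → x = 1) ∧
      (2 ≤ β.card → β ≠ {0, 1} → ∃ s, x = walshStep (P β) (a β) (b β) s f ∧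
        (2 ^ (P β).card - 1) * |f (P β ∪ a β)| ≤ |x|))
    (by
      intro β f
      by_cases h1 : β.card ≤ 1
      · refine ⟨0, fun _ => rfl, ?_, fun h => absurd h1 (by omega)⟩
        rintro rfl
        simp at h1
      by_cases h2 : β = {0, 1}
      · exact ⟨1, fun h => absurd h h1, fun _ => rfl, fun _ h => absurd h2 h⟩
      obtain ⟨s, hs⟩ := exists_le_abs_walshStep (P β) (a β) (b β) f
      exact ⟨_, fun h => absurd h h1, fun h => absurd h h2, fun _ _ => ⟨s, rfl, hs⟩⟩)
    (by
      rintro β f f' x hf ⟨h1, h2, h3⟩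
      refine ⟨h1, h2, fun h4 h5 => ?_⟩
      obtain ⟨s, hs, hg⟩ := h3 h4 h5
      have hsp := hP β h4 h5
      refine ⟨s, by rw [hs, hsp.walshStep_congr s hf], ?_⟩
      rwa [← hf _ (hsp.left_lt _ (Finset.Subset.refl _))])
  have hs : ∀ β : Finset ℕ, ∃ s, 2 ≤ β.card → β ≠ {0, 1} →
      X β = walshStep (P β) (a β) (b β) s X ∧
        (2 ^ (P β).card - 1) * |X (P β ∪ a β)| ≤ |X β| := by
    intro β
    by_cases h : 2 ≤ β.card ∧ β ≠ {0, 1}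
    · obtain ⟨s, hs⟩ := (hX β).2.2 h.1 h.2
      exact ⟨s, fun _ _ => hs⟩
    · exact ⟨∅, fun h1 h2 => absurd ⟨h1, h2⟩ h⟩
  choose s hs using hs
  exact ⟨P, a, b, s, X, hP, fun β => (hX β).1, (hX _).2.1 rfl, fun β h h' => (hs β h h').1,
    fun β h h' => (hs β h h').2⟩

theorem IsHastadData.two_pow_le_abs {P a b s : Finset ℕ → Finset ℕ} {X : Finset ℕ → ℤ}
    (h : IsHastadData P a b s X) (m : ℕ) (β : Finset ℕ) (hβ : 2 ≤ β.card) :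
    2 ^ (∑ γ ∈ (Finset.range m).powerset.filter (fun γ => binVal γ ≤ binVal β), (γ.card - 2)) ≤
      |X β| := by
  by_cases hpair : β = {0, 1}
  · subst hpair
    rw [h.pair, Finset.sum_eq_zero]
    · simp
    · intro γ hγ
      have h1 : binVal γ < 2 ^ 2 := by
        refine (Finset.mem_filter.1 hγ).2.trans_lt ?_
        rw [Finset.insert_eq, binVal_union (by simp)]
        simp
      have := Finset.card_le_card (binVal_lt_two_pow_iff.1 h1)
      rw [Finset.card_range] at this
      omega
  · have hsp := h.split β hβ hpair
    have hlt := hsp.left_lt _ (Finset.Subset.refl _)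
    have ih := IsHastadData.two_pow_le_abs h m (P β ∪ a β) hsp.two_le_card
    refine le_trans ?_ ((mul_le_mul_of_nonneg_left ih ?_).trans (h.growth β hβ hpair))
    · have hsum : ∑ γ ∈ (Finset.range m).powerset.filter (fun γ => binVal γ ≤ binVal β),
          (γ.card - 2) ≤ (β.card - 2) + ∑ γ ∈ (Finset.range m).powerset.filter
            (fun γ => binVal γ ≤ binVal (P β ∪ a β)), (γ.card - 2) := by
        have hnot : β ∉ (Finset.range m).powerset.filter
            (fun γ => binVal γ ≤ binVal (P β ∪ a β)) := by
          simp [hlt]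
        rw [← Finset.sum_insert (f := fun γ : Finset ℕ => γ.card - 2) hnot]
        refine Finset.sum_le_sum_of_ne_zero fun γ hγ hne => ?_
        rw [Finset.mem_filter] at hγ
        rw [Finset.mem_insert, Finset.mem_filter]
        rcases hγ.2.eq_or_lt with heq | hγlt
        · exact Or.inl (binVal_injective heq)
        · exact Or.inr ⟨hγ.1, hsp.gap γ (by omega) hγlt⟩
      refine (pow_le_pow_right₀ (by norm_num) hsum).trans ?_
      rw [pow_add]
      refine mul_le_mul_of_nonneg_right ?_ (by positivity)
      have hc := hsp.card_add_one
      obtain ⟨k, hk⟩ : ∃ k, (P β).card = k + 1 := ⟨(P β).card - 1, by omega⟩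
      rw [hk, show β.card - 2 = k by omega, pow_succ]
      have := one_le_pow₀ (n := k) (show (1 : ℤ) ≤ 2 by norm_num)
      omega
    · have := one_le_pow₀ (n := (P β).card) (show (1 : ℤ) ≤ 2 by norm_num)
      omega
termination_by binVal β

/-- There are `±1` matrices all of whose integer kernel vectors are long. -/
theorem exists_pm_matrix_kernel_large {m : ℕ} (hm : 2 ≤ m) :
    ∃ A : Matrix (Finset.range m).powerset (Finset.range m).powerset ℤ,
      (∀ r i, A r i = 1 ∨ A r i = -1) ∧ (∃ g, g ≠ 0 ∧ A.mulVec g = 0) ∧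
      ∀ g, A.mulVec g = 0 → g ≠ 0 →
        2 ^ (∑ γ ∈ (Finset.range m).powerset, (γ.card - 2)) ≤ ∑ i, |g i| := by
  obtain ⟨P, a, b, s, X, h⟩ := exists_isHastadData
  let A : Matrix (Finset.range m).powerset (Finset.range m).powerset ℤ := fun β y =>
    if (β : Finset ℕ).card ≤ 1 then setChar β y else if (β : Finset ℕ) = {0, 1} then 1
    else cubeFlip (P β) (s β) (P β ∪ a β) β y
  have hpair : ({0, 1} : Finset ℕ) ⊆ Finset.range m := by
    intro c hc
    simp at hc ⊢
    omega
  refine ⟨A, fun β y => ?_, ?_, fun g hg hg0 => ?_⟩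
  · simp only [A]
    split_ifs
    · exact setChar_eq_one_or _ _
    · exact Or.inl rfl
    · exact cubeFlip_eq_one_or _ _ _ _ _
  · refine Matrix.exists_mulVec_eq_zero_iff.2 (Matrix.det_zero_of_row_eq
      (i := ⟨∅, Finset.empty_mem_powerset _⟩) (j := ⟨{0, 1}, Finset.mem_powerset.2 hpair⟩) ?_ ?_)
    · intro h'
      simpa using congrArg (fun z => (Subtype.val z).card) h'
    · funext y
      simp [A]
  · have hrow : ∀ β (hβ : β ⊆ Finset.range m),
        ∑ y, A ⟨β, Finset.mem_powerset.2 hβ⟩ y * g y = 0 := fun β hβ => congrFun hg _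
    have hmul : ∀ β, β ⊆ Finset.range m → walsh g β = X β * walsh g {0, 1} := by
      intro β hβ
      induction hN : binVal β using Nat.strong_induction_on generalizing β with
      | _ N ih =>
        subst hN
        have hr := hrow β hβ
        by_cases h1 : β.card ≤ 1
        · simp only [A, h1, if_true] at hr
          rw [h.eq_zero β h1, zero_mul]
          exact hr
        by_cases h2 : β = {0, 1}
        · rw [h2, h.pair, one_mul]
        have hsp := h.split β (by omega) h2
        simp only [A, h1, h2, if_false] at hr
        have hw := walsh_eq_of_sum_cubeFlip_eq_zero (g := g) (s := s β) hsp.disjoint_left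
          hsp.disjoint_right (by rw [← hsp.eq_union]; exact hr)
        rw [← hsp.eq_union] at hw
        rw [hw, h.step β (by omega) h2, ← walshStep_mul]
        refine hsp.walshStep_congr (s β) (f := walsh g) fun γ hγ => ih _ hγ γ ?_ rfl
        exact binVal_lt_two_pow_iff.1 (hγ.trans (binVal_lt_two_pow_iff.2 hβ))
    have hne : walsh g {0, 1} ≠ 0 := by
      intro h0
      have hsq := sum_walsh_sq g
      rw [Finset.sum_eq_zero (fun β _ => by
        rw [hmul β (Finset.mem_powerset.1 β.2), h0, mul_zero, sq, mul_zero])] at hsq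
      have hcard : (Fintype.card (Finset.range m).powerset : ℤ) ≠ 0 := by
        rw [Fintype.card_coe, Finset.card_powerset]
        positivity
      have hz := (mul_eq_zero.1 hsq.symm).resolve_left hcard
      refine hg0 (funext fun y => ?_)
      have := (Finset.sum_eq_zero_iff_of_nonneg (fun i _ => sq_nonneg (g i))).1 hz y
        (Finset.mem_univ y)
      exact pow_eq_zero_iff two_ne_zero |>.1 this
    have hX := h.two_pow_le_abs m (Finset.range m) (by rwa [Finset.card_range])
    rw [Finset.filter_true_of_mem fun γ hγ => binVal_mono (Finset.mem_powerset.1 hγ)] at hX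
    calc (2 : ℤ) ^ (∑ γ ∈ (Finset.range m).powerset, (γ.card - 2))
        ≤ |X (Finset.range m)| * 1 := by rwa [mul_one]
      _ ≤ |X (Finset.range m)| * |walsh g {0, 1}| :=
          mul_le_mul_of_nonneg_left (Int.one_le_abs hne) (abs_nonneg _)
      _ = |walsh g (Finset.range m)| := by
          rw [hmul _ (Finset.Subset.refl _), abs_mul]
      _ ≤ ∑ y : (Finset.range m).powerset, |setChar (Finset.range m) y * g y| :=
          Finset.abs_sum_le_sum_abs _ _
      _ = ∑ y, |g y| := by
          refine Finset.sum_congr rfl fun y _ => ?_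
          rcases setChar_eq_one_or (Finset.range m) y with h' | h' <;> simp [h']

theorem sum_card_powerset_mul_two (s : Finset ℕ) :
    (∑ γ ∈ s.powerset, γ.card) * 2 = s.card * 2 ^ s.card := by
  have h : ∑ γ ∈ s.powerset, γ.card = ∑ γ ∈ s.powerset, (s \ γ).card := by
    refine Finset.sum_nbij' (fun γ => s \ γ) (fun γ => s \ γ) ?_ ?_ ?_ ?_ ?_ <;> intro γ hγ <;>
      rw [Finset.mem_powerset] at * <;> simp [hγ]
  rw [mul_two]
  nth_rw 2 [h]
  rw [← Finset.sum_add_distrib, Finset.sum_congr rfl fun γ hγ =>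
    (show γ.card + (s \ γ).card = s.card by
      rw [add_comm, Finset.card_sdiff_add_card_eq_card (Finset.mem_powerset.1 hγ)]),
    Finset.sum_const, Finset.card_powerset, smul_eq_mul, mul_comm]

theorem one_le_tauPM (d : ℕ) : 1 ≤ tauPM d := by
  refine (tauPM_isGreatest d).2 ⟨fun _ _ => 1, fun _ _ => Or.inl rfl, ?_, ?_, ?_⟩
  · intro i j
    norm_num
  · intro j
    simp
  · intro S h2 h1
    omega

theorem two_pow_le_tauPM {m : ℕ} (hm : 2 ≤ m) :
    2 ^ (∑ γ ∈ (Finset.range m).powerset, (γ.card - 2)) ≤ tauPM (2 ^ (m + 1)) := by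
  obtain ⟨A, hA, ⟨g₀, hg₀, hAg₀⟩, hlarge⟩ := exists_pm_matrix_kernel_large hm
  obtain ⟨g, ⟨hg, hAg⟩, hmin⟩ := WellFounded.has_min
    (measure fun x : (Finset.range m).powerset → ℤ => ∑ i, (x i).natAbs).wf
    {x | x ≠ 0 ∧ A.mulVec x = 0} ⟨g₀, hg₀, hAg₀⟩
  have habs : ∀ x : (Finset.range m).powerset → ℤ,
      ∑ i, |x i| = ((∑ i, (x i).natAbs : ℕ) : ℤ) := fun x => by
    push_cast
    rfl
  let H : Matrix (Finset.range m).powerset (Finset.range m).powerset ℤ := fun β y => setChar β y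
  have hcard : Fintype.card ((Finset.range m).powerset ⊕ (Finset.range m).powerset) =
      2 ^ (m + 1) := by
    rw [Fintype.card_sum, Fintype.card_coe, Finset.card_powerset, Finset.card_range, pow_succ,
      mul_two]
  have hmem := two_mul_sum_natAbs_sub_one_mem_pmLengths (A := A) (H := H) hA
    (fun _ _ => setChar_eq_one_or _ _) sum_walsh_sq hAg hg
    (fun x hx hx0 => by
      rw [habs, habs]
      exact_mod_cast not_lt.1 (hmin x ⟨hx0, hx⟩))
    (Fintype.equivFinOfCardEq hcard).symm
  have hg_large := hlarge g hAg hg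
  rw [habs] at hg_large
  have hg_large' : 2 ^ (∑ γ ∈ (Finset.range m).powerset, (γ.card - 2)) ≤ ∑ i, (g i).natAbs := by
    exact_mod_cast hg_large
  have hle := (tauPM_isGreatest _).2 hmem
  have hpos : 0 < 2 ^ (∑ γ ∈ (Finset.range m).powerset, (γ.card - 2)) := by positivity
  omega

theorem theorem3 :
    ∃ c : ℝ, 0 < c ∧ ∀ d : ℕ, (∃ k : ℕ, d = 2 ^ k) →
      (c * (d : ℝ)) ^ ((d : ℝ) / 4) ≤ (tauPM d : ℝ) := by
  refine ⟨1 / 32, by norm_num, ?_⟩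
  rintro d ⟨k, rfl⟩
  rcases lt_or_ge k 3 with hk | hk
  · refine le_trans (Real.rpow_le_one (by positivity) ?_ (by positivity))
      (by exact_mod_cast one_le_tauPM _)
    interval_cases k <;> norm_num
  · obtain ⟨m, rfl⟩ : ∃ m, k = m + 1 := ⟨k - 1, by omega⟩
    set E := ∑ γ ∈ (Finset.range m).powerset, (γ.card - 2) with hE
    have htau : ((2 : ℝ) ^ E) ≤ tauPM (2 ^ (m + 1)) := by
      exact_mod_cast two_pow_le_tauPM (m := m) (by omega)
    refine le_trans ?_ htau
    have hEsum : m * 2 ^ m ≤ E * 2 + 4 * 2 ^ m := by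
      have h1 := sum_card_powerset_mul_two (Finset.range m)
      have h2 : ∑ γ ∈ (Finset.range m).powerset, γ.card ≤ E + 2 * 2 ^ m := by
        have h3 : 2 * 2 ^ m = ∑ γ ∈ (Finset.range m).powerset, 2 := by simp [mul_comm]
        rw [hE, h3, ← Finset.sum_add_distrib]
        exact Finset.sum_le_sum fun γ _ => by omega
      rw [Finset.card_range] at h1
      omega
    have hbase : (1 / 32 * ((2 ^ (m + 1) : ℕ) : ℝ)) = (2 : ℝ) ^ ((m : ℝ) - 4) := by
      rw [Real.rpow_sub (by norm_num), Real.rpow_natCast]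
      push_cast
      norm_num
      ring
    rw [hbase, ← Real.rpow_mul (by norm_num), ← Real.rpow_natCast]
    refine Real.rpow_le_rpow_of_exponent_le (by norm_num) ?_
    have hcast : (m : ℝ) * 2 ^ m ≤ E * 2 + 4 * 2 ^ m := by exact_mod_cast hEsum
    push_cast
    rw [pow_succ]
    linarith
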